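/- Let $k$ be a field, $n\ge 0$, and $D=k[d_1,\dots,d_n]$ the (commutative) ring of differential operators with constant coefficients. Let $M$ be a non-zero differential module defined by an involutive first-order system without zero-order equations, in the given ($\delta$-regular) coordinates. That is, $M=D^m/(D\Phi^1+\dots+D\Phi^p)$ with generators $y^1,\dots,y^m$ (the residue classes of the standard basis), where each equation $\Phi^\tau$ is a row in $D^m$ of order one with a class $c_\tau\in\{1,\dots,n\}$ such that: * $\Phi^\tau$ is solved with respect to a principal jet $d_{c_\tau}y^{l_\tau}$ (its coefficient in $\Phi^\tau$ is $1$, and it occurs in no other equation), and $\Phi^\tau$ contains no $d_jy^l$ with $j>c_\tau$; * (involution) for all $\tau$ and $j$, the prolongation $d_j\Phi^\tau$ is a $k$-linear combination of the $\Phi^\sigma$ and of the prolongations $d_i\Phi^\sigma$ with $i\le c_\sigma$ (multiplicative variables only). For a finitely generated $D$-module $N$, filtered by $N_q=D_qS$ with $S$ a finite generating set and $D_q$ the operators of order $\le q$, the characteristic ideal of $N$ is the radical of the annihilator in $\operatorname{gr} D=k[\chi_1,\dots,\chi_n]$ of $\operatorname{gr} N$ (it does not depend on $S$), and $cd(N)$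 is $n$ minus the dimension of the variety it defines, with $cd(0)=\infty$. Put $t_s(M)=\{x\in M\mid cd(Dx)>s\}$ for $s\ge 0$ and $t_{-1}(M)=M$. The module $M$ is called $r$-pure if $t_r(M)=0$ and $t_{r-1}(M)=M$. Let $0\le r\le n$. Then $M$ is $r$-pure if and only if $cd(M)=r$ and the relative localization morphism $$M\longrightarrow k(\chi_1,\dots,\chi_{n-r})\otimes_{k[d_1,\dots,d_{n-r}]}M,\qquad x\longmapsto 1\otimes x,$$ is a monomorphism, where $d_i$ acts on $k(\chi_1,\dots,\chi_{n-r})$ as multiplication by $\chi_i$. -/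

import Mathlib

open scoped TensorProduct

section DifferentialModules

/-! Throughout, `MvPolynomial (Fin n) k` plays two roles, as usual for constant coefficients:
it is the ring `D = k[d₁, …, dₙ]` of differential operators and its associated graded ring
`gr D = k[χ₁, …, χₙ]`. The index `i : Fin n` stands for the variable number `i + 1`. -/

variable {k : Type*} [Field k] {n : ℕ}

/-- An involutive first order system with `p` equations for the unknowns `y¹, …, yᵐ` and without
zero order equations, solved with respect to its principal first order jets.

The equation `Φ τ` is a row of operators `(Φ τ 1, …, Φ τ m)`, standing for `∑ l, (Φ τ l) yˡ = 0`.
The coefficient of the jet `yˡᵢ` in it is the coefficient of `X i` in `Φ τ l`. The equation `Φ τ`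
has class `cls τ` and is solved with respect to the principal jet `y^(piv τ)_(cls τ)`; its
multiplicative variables are those with index `≤ cls τ`. -/
structure IsInvolutiveFirstOrder {m p : ℕ} (Φ : Fin p → Fin m → MvPolynomial (Fin n) k)
    (cls : Fin p → Fin n) (piv : Fin p → Fin m) : Prop where
  /-- the equations have order at most one -/
  order_le : ∀ τ l, (Φ τ l).totalDegree ≤ 1
  /-- the principal jet of an equation occurs in it with coefficient one -/
  principal : ∀ τ, (Φ τ (piv τ)).coeff (Finsupp.single (cls τ) 1) = 1
  /-- the principal jet of an equation occurs in no other equation -/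
  solved : ∀ τ σ, σ ≠ τ → (Φ σ (piv τ)).coeff (Finsupp.single (cls τ) 1) = 0
  /-- an equation of class `i` contains no jet of class greater than `i` -/
  class_le : ∀ τ l j, cls τ < j → (Φ τ l).coeff (Finsupp.single j 1) = 0
  /-- involution: the first prolongation of the system is already obtained by prolonging each
  equation with respect to its multiplicative variables only -/
  prolongation : ∀ τ j, (MvPolynomial.X j : MvPolynomial (Fin n) k) • Φ τ ∈
    Submodule.span k (Set.range Φ ∪
      {Ψ | ∃ σ i, i ≤ cls σ ∧ Ψ = (MvPolynomial.X i : MvPolynomial (Fin n) k) • Φ σ})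

variable (k n)
variable (M : Type*) [AddCommGroup M] [Module (MvPolynomial (Fin n) k) M]

variable {M} in
/-- The filtration `M_q = D_q S` of a module generated by `S`, where `D_q` is the space of the
operators of order at most `q`. It is indexed by `q : ℤ`, so that `M_q = 0` for `q < 0`. -/
noncomputable def orderFiltration (S : Set M) (q : ℤ) : AddSubgroup M :=
  AddSubgroup.closure
    {x | ∃ P : MvPolynomial (Fin n) k, (P.totalDegree : ℤ) ≤ q ∧ ∃ s ∈ S, x = P • s}

variable {M} in
/-- The annihilator in `k[χ₁, …, χₙ]` of the graded module `gr M = ⨁ M_q / M_{q-1}` for the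
filtration `M_q = D_q S`. This is a homogeneous ideal, generated by the homogeneous `P`, of some
degree `e`, such that all the maps `P : M_q / M_{q-1} → M_{q+e} / M_{q+e-1}` vanish. -/
noncomputable def gradedAnnihilator (S : Set M) : Ideal (MvPolynomial (Fin n) k) :=
  Ideal.span {P | ∃ e : ℕ, P.IsHomogeneous e ∧
    ∀ q : ℤ, ∀ x ∈ orderFiltration k n S q, P • x ∈ orderFiltration k n S (q + e - 1)}

/-- The characteristic ideal of a finitely generated module `M`: the radical of the annihilator of
`gr M`. It is the same ideal for all finite generating sets `S`, whence the intersection. -/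
noncomputable def characteristicIdeal : Ideal (MvPolynomial (Fin n) k) :=
  ⨅ (S : Finset M) (_ : Submodule.span (MvPolynomial (Fin n) k) (S : Set M) = ⊤),
    (gradedAnnihilator k n (S : Set M)).radical

/-- The codimension `cd(M)`: `n` minus the dimension of the characteristic variety of `M`, with
the convention `cd(0) = ∞` (the characteristic variety of the zero module is empty). -/
noncomputable def codim : ℕ∞ :=
  WithBot.recBotCoe (C := fun _ => ℕ∞) ⊤ (fun d => (n : ℕ∞) - d)
    (ringKrullDim (MvPolynomial (Fin n) k ⧸ characteristicIdeal k n M))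

/-- The purity filtration `t_r(M) = {x ∈ M | cd(D x) > r}`. -/
def purityFiltration (r : ℕ) : Set M :=
  {x | (r : ℕ∞) < codim k n (Submodule.span (MvPolynomial (Fin n) k) {x})}

/-- `M` is `r`-pure: `t_r(M) = 0` and `t_{r-1}(M) = M`, where `t_{-1}(M) = M` by convention. -/
def IsPure (r : ℕ) : Prop :=
  purityFiltration k n M r = {0} ∧ ∀ s, s + 1 = r → purityFiltration k n M s = Set.univ

/-- A module over `k[d₁, …, dₙ]`, seen as a module over `k[d₁, …, dₛ]` for `s ≤ n`. -/
noncomputable abbrev restrictVariables {s : ℕ} (hs : s ≤ n) : Module (MvPolynomial (Fin s) k) M :=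
  Module.compHom M
    (MvPolynomial.rename (R := k) (Fin.castLE hs)).toRingHom

/-- The relatively localized module `k(χ₁, …, χₛ) ⊗ M`, the tensor product being taken over
`k[d₁, …, dₛ]` with `dᵢ` acting on `k(χ₁, …, χₛ)` as multiplication by `χᵢ`. -/
abbrev RelativeLocalization {s : ℕ} (hs : s ≤ n) : Type _ :=
  letI := restrictVariables k n M hs
  FractionRing (MvPolynomial (Fin s) k) ⊗[MvPolynomial (Fin s) k] M

/-- The relative localization morphism `M → k(χ₁, …, χₛ) ⊗ M`, `x ↦ 1 ⊗ x`. -/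
noncomputable def relativeLocalizationMap {s : ℕ} (hs : s ≤ n) :
    M → RelativeLocalization k n M hs :=
  letI := restrictVariables k n M hs
  fun x => (1 : FractionRing (MvPolynomial (Fin s) k)) ⊗ₜ[MvPolynomial (Fin s) k] x

end DifferentialModules

/-! ### Krull dimension of integral extensions -/

section IntegralExtensions

/-! Let `s` be minimal such that every jet of class greater than `s` is principal (classes counted
from 1), and put `A = k[d₁, …, dₛ]`. Everything follows from one fact: each `Dx` has codimension at
least `n - s`, with equality exactly when no nonzero element of `A` kills `x`.

Finiteness. For a class `h > s`, the `m` equations of class `h` form a square matrix `d_h + B + B₀`,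
with `B` linear in earlier variables and `B₀` constant. By Cramer its determinant kills `M`, and its
leading form, where `B₀` is dropped, lies in the characteristic ideal. So `D / ann M` and `gr D`
modulo the characteristic ideal are both integral over the polynomials in `s` variables. This passes
to every `Dx` and gives `n - s ≤ cd(Dx)`. A nonzero `p ∈ A` killing `x` has a nonzero leading form
in the characteristic ideal, which makes the inequality strict (`IsTriangular.lt_codim`).

Freeness. If `x` is free over `A`, then `A` embeds into `D / ann(Dx)`, and one has to see that
`k[χ₁, …, χₛ]` embeds on the graded side as well. This is `IsTriangular.eq_zero_of_isLeadingForm`,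
proved by integrality over the Rees algebra of `A`.

Involution enters only to give a free generator, whence `cd(M) = n - s`. Combinations of the
equations with multiplicative coefficients exhaust the module of equations, and their highest class
cannot cancel, so a generator with a nonprincipal jet of class `s` is free over `A`.

Both sides of the theorem force `s = n - r`. Then `t_r(M)` is the `A`-torsion of `M`, which is the
kernel of the localization. -/

theorem ringKrullDim_le_of_isIntegral {R S : Type*} [CommRing R] [CommRing S] (f : R →+* S)
    (hf : f.IsIntegral) : ringKrullDim S ≤ ringKrullDim R := by
  let := f.toAlgebra
  have : Algebra.IsIntegral R S := ⟨hf⟩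
  refine Order.krullDim_le_of_strictMono (PrimeSpectrum.comap (algebraMap R S)) ?_
  intro P Q hPQ
  exact Ideal.IsIntegral.comap_lt_comap (R := R) (I := P.asIdeal) (J := Q.asIdeal) hPQ

/-- Lying over provides a prime above the head of a chain, and going up lifts the rest of the chain.
-/
theorem ringKrullDim_le_of_isIntegral_of_injective {R S : Type*} [CommRing R] [CommRing S]
    (f : R →+* S) (hf : f.IsIntegral) (hinj : Function.Injective f) :
    ringKrullDim R ≤ ringKrullDim S := by
  let := f.toAlgebra
  have : Algebra.IsIntegral R S := ⟨hf⟩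
  refine iSup_le fun l => ?_
  obtain ⟨Q, -, hQ, hQl⟩ := Ideal.exists_ideal_over_prime_of_isIntegral (S := S)
    (RelSeries.head l).asIdeal ⊥ (by
      rw [← RingHom.ker_eq_comap_bot]
      exact ((RingHom.injective_iff_ker_eq_bot f).1 hinj).trans_le bot_le)
  have : Q.LiesOver (RelSeries.head l).asIdeal := ⟨hQl.symm⟩
  obtain ⟨L, hL, -⟩ := Ideal.exists_ltSeries_of_hasGoingUp l Q
  rw [← hL]
  exact Order.LTSeries.length_le_krullDim L

/-- The map factors through `R / (x)`, and dividing by a nonzerodivisor lowers the dimension. -/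
theorem ringKrullDim_succ_le_of_isIntegral {R S : Type*} [CommRing R] [CommRing S]
    (f : R →+* S) (hf : f.IsIntegral) {x : R} (hx : x ∈ nonZeroDivisors R) (hfx : f x = 0) :
    ringKrullDim S + 1 ≤ ringKrullDim R := by
  have hle : Ideal.span {x} ≤ RingHom.ker f := by
    rw [Ideal.span_le]
    simpa using hfx
  let g := Ideal.Quotient.lift (Ideal.span {x}) f fun a ha => hle ha
  have hg : g.IsIntegral := by
    refine RingHom.IsIntegral.tower_top (Ideal.Quotient.mk (Ideal.span {x})) g ?_
    exact (Ideal.Quotient.lift_comp_mk (Ideal.span {x}) f fun a ha => hle ha).symm ▸ hf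
  exact (add_le_add_left (ringKrullDim_le_of_isIntegral g hg) 1).trans
    (ringKrullDim_quotient_succ_le_of_nonZeroDivisor hx)

/-- The subring of the elements which are integral with respect to a ring homomorphism. -/
def RingHom.integralSubring {A R : Type*} [CommRing A] [CommRing R] (f : A →+* R) : Subring R :=
  letI := f.toAlgebra
  (integralClosure A R).toSubring

theorem RingHom.mem_integralSubring {A R : Type*} [CommRing A] [CommRing R] (f : A →+* R) {x : R} :
    x ∈ f.integralSubring ↔ f.IsIntegralElem x := Iff.rfl

theorem RingHom.map_mem_integralSubring {A R : Type*} [CommRing A] [CommRing R] (f : A →+* R)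
    (x : A) : f x ∈ f.integralSubring :=
  f.isIntegralElem_map

/-- If `x + B` is singular for a square matrix `B` with integral entries, then `x` is integral. -/
theorem RingHom.mem_integralSubring_of_det_eq_zero {A R : Type*} [CommRing A] [CommRing R]
    (f : A →+* R) {ι : Type*} [Fintype ι] [DecidableEq ι] (x : R) (B : Matrix ι ι R)
    (hB : ∀ i j, B i j ∈ f.integralSubring) (hdet : (Matrix.scalar ι x + B).det = 0) :
    x ∈ f.integralSubring := by
  let := f.toAlgebra
  let B' : Matrix ι ι (integralClosure A R) := fun i j => ⟨B i j, hB i j⟩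
  have hBB' : (-B').map (algebraMap (integralClosure A R) R) = -B := by
    ext i j
    simp [B']
    rfl
  have hx : _root_.IsIntegral (integralClosure A R) x := by
    -- `x` is a root of the characteristic polynomial of `-B`, which is monic with integral
    -- coefficients.
    refine ⟨(-B').charpoly, Matrix.charpoly_monic _, ?_⟩
    rw [← Polynomial.eval_map, ← Matrix.charpoly_map, hBB', Matrix.eval_charpoly, sub_neg_eq_add,
      hdet]
  exact isIntegral_trans (R := A) x hx

end IntegralExtensions

/-! ### Leading forms -/

section LeadingForms

open MvPolynomial

variable {k : Type*} [Field k] {σ : Type*}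

variable (k σ) in
/-- The polynomials of total degree less than `e`. -/
def degreeLT (e : ℕ) : Submodule k (MvPolynomial σ k) where
  carrier := {p | ∀ d : σ →₀ ℕ, e ≤ d.degree → p.coeff d = 0}
  add_mem' {p q} hp hq d hd := by simp [hp d hd, hq d hd]
  zero_mem' d _ := by simp
  smul_mem' c p hp d hd := by simp [hp d hd]

theorem mem_degreeLT {e : ℕ} {p : MvPolynomial σ k} :
    p ∈ degreeLT k σ e ↔ ∀ d : σ →₀ ℕ, e ≤ d.degree → p.coeff d = 0 := Iff.rfl

theorem degreeLT_zero : degreeLT k σ 0 = ⊥ := by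
  refine le_antisymm (fun p hp => ?_) bot_le
  rw [Submodule.mem_bot]
  ext d
  simpa using hp d (Nat.zero_le _)

theorem mem_degreeLT_succ {e : ℕ} {p : MvPolynomial σ k} :
    p ∈ degreeLT k σ (e + 1) ↔ p.totalDegree ≤ e := by
  rw [mem_degreeLT, totalDegree, Finset.sup_le_iff]
  constructor
  · intro h d hd
    by_contra hlt
    push Not at hlt
    exact (mem_support_iff.1 hd) (h d (show e < d.degree from hlt))
  · intro h d hd
    by_contra hne
    have := h d (mem_support_iff.2 hne)
    change d.degree ≤ e at this
    omega

theorem degreeLT_mono {a b : ℕ} (h : a ≤ b) : degreeLT k σ a ≤ degreeLT k σ b :=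
  fun _ hp d hd => hp d (h.trans hd)

theorem mul_mem_degreeLT {a b c : ℕ} {p q : MvPolynomial σ k} (hp : p ∈ degreeLT k σ (a + 1))
    (hq : q ∈ degreeLT k σ b) (h : a + b ≤ c) : p * q ∈ degreeLT k σ c := by
  cases b with
  | zero =>
    rw [degreeLT_zero, Submodule.mem_bot] at hq
    simp [hq]
  | succ b =>
    rw [mem_degreeLT_succ] at hp hq
    refine degreeLT_mono h ?_
    rw [← add_assoc, mem_degreeLT_succ]
    exact (totalDegree_mul _ _).trans (add_le_add hp hq)

theorem MvPolynomial.IsHomogeneous.mem_degreeLT {e : ℕ} {p : MvPolynomial σ k}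
    (hp : p.IsHomogeneous e) : p ∈ degreeLT k σ (e + 1) :=
  mem_degreeLT_succ.2 hp.totalDegree_le

theorem MvPolynomial.IsHomogeneous.eq_zero_of_mem_degreeLT {e : ℕ} {p : MvPolynomial σ k}
    (hp : p.IsHomogeneous e) (h : p ∈ degreeLT k σ e) : p = 0 := by
  ext d
  by_cases hd : e ≤ d.degree
  · simpa using h d hd
  · simpa using hp.coeff_eq_zero (by omega)

/-- `f` is the form of degree `e` of the polynomial `p` of degree at most `e`. -/
structure IsLeadingForm (e : ℕ) (f p : MvPolynomial σ k) : Prop where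
  isHomogeneous : f.IsHomogeneous e
  sub_mem : p - f ∈ degreeLT k σ e

namespace IsLeadingForm

theorem mem_degreeLT {e : ℕ} {f p : MvPolynomial σ k} (h : IsLeadingForm e f p) :
    p ∈ degreeLT k σ (e + 1) := by
  have := add_mem (degreeLT_mono (Nat.le_succ e) h.sub_mem) h.isHomogeneous.mem_degreeLT
  simpa using this

/-- A leading form may be zero, `e` being only a bound for the degree, so cancellation does no harm.
-/
theorem add {e : ℕ} {f g p q : MvPolynomial σ k} (hp : IsLeadingForm e f p)
    (hq : IsLeadingForm e g q) : IsLeadingForm e (f + g) (p + q) :=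
  ⟨hp.1.add hq.1, by simpa [add_sub_add_comm] using add_mem hp.2 hq.2⟩

theorem neg {e : ℕ} {f p : MvPolynomial σ k} (hp : IsLeadingForm e f p) :
    IsLeadingForm e (-f) (-p) := by
  refine ⟨hp.1.neg, ?_⟩
  have := neg_mem hp.2
  rwa [neg_sub, ← neg_sub_neg] at this

theorem zero (e : ℕ) : IsLeadingForm e (0 : MvPolynomial σ k) 0 :=
  ⟨isHomogeneous_zero _ _ _, by simp⟩

theorem one : IsLeadingForm 0 (1 : MvPolynomial σ k) 1 :=
  ⟨isHomogeneous_one _ _, by simp⟩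

theorem mul {a b : ℕ} {f g p q : MvPolynomial σ k} (hp : IsLeadingForm a f p)
    (hq : IsLeadingForm b g q) : IsLeadingForm (a + b) (f * g) (p * q) := by
  refine ⟨hp.1.mul hq.1, ?_⟩
  have : p * q - f * g = q * (p - f) + f * (q - g) := by ring
  rw [this]
  exact add_mem (mul_mem_degreeLT hq.mem_degreeLT hp.2 (by omega))
    (mul_mem_degreeLT hp.1.mem_degreeLT hq.2 le_rfl)

theorem sum {ι : Type*} (s : Finset ι) {e : ℕ} {f p : ι → MvPolynomial σ k}
    (h : ∀ i ∈ s, IsLeadingForm e (f i) (p i)) :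
    IsLeadingForm e (∑ i ∈ s, f i) (∑ i ∈ s, p i) := by
  classical
  induction s using Finset.induction_on with
  | empty => simpa using zero e
  | insert a s ha ih =>
    rw [Finset.sum_insert ha, Finset.sum_insert ha]
    exact (h a (by simp)).add (ih fun i hi => h i (by simp [hi]))

theorem prod {ι : Type*} (s : Finset ι) {e : ℕ} {f p : ι → MvPolynomial σ k}
    (h : ∀ i ∈ s, IsLeadingForm e (f i) (p i)) :
    IsLeadingForm (s.card * e) (∏ i ∈ s, f i) (∏ i ∈ s, p i) := by
  classical
  induction s using Finset.induction_on with
  | empty => simpa using one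
  | insert a s ha ih =>
    rw [Finset.prod_insert ha, Finset.prod_insert ha, Finset.card_insert_of_notMem ha, add_mul,
      one_mul, add_comm]
    exact (h a (by simp)).mul (ih fun i hi => h i (by simp [hi]))

theorem det {ι : Type*} [Fintype ι] [DecidableEq ι] {e : ℕ}
    {F P : Matrix ι ι (MvPolynomial σ k)} (h : ∀ i j, IsLeadingForm e (F i j) (P i j)) :
    IsLeadingForm (Fintype.card ι * e) F.det P.det := by
  rw [Matrix.det_apply, Matrix.det_apply]
  refine sum _ fun τ _ => ?_
  have := prod Finset.univ (f := fun i => F (τ i) i) (p := fun i => P (τ i) i)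
    (fun i _ => h (τ i) i)
  rcases Int.units_eq_one_or (Equiv.Perm.sign τ) with hs | hs
  · simpa [hs] using this
  · simpa [hs] using this.neg

end IsLeadingForm

theorem isLeadingForm_homogeneousComponent {e : ℕ} {p : MvPolynomial σ k}
    (hp : p ∈ degreeLT k σ (e + 1)) : IsLeadingForm e (homogeneousComponent e p) p := by
  refine ⟨homogeneousComponent_isHomogeneous _ _, fun d hd => ?_⟩
  rw [coeff_sub, coeff_homogeneousComponent]
  split_ifs with h
  · simp
  · simpa using hp d (by omega)

theorem homogeneousComponent_X_mul (e : ℕ) (i : σ) (p : MvPolynomial σ k) :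
    homogeneousComponent (e + 1) (X i * p) = X i * homogeneousComponent e p := by
  classical
  ext d
  rw [coeff_homogeneousComponent, coeff_X_mul', coeff_X_mul', coeff_homogeneousComponent]
  by_cases hi : i ∈ d.support
  · have hd : d = (d - Finsupp.single i 1) + Finsupp.single i 1 := by
      refine (tsub_add_cancel_of_le ?_).symm
      rw [Finsupp.single_le_iff]
      exact Nat.one_le_iff_ne_zero.2 (Finsupp.mem_support_iff.1 hi)
    have : d.degree = (d - Finsupp.single i 1).degree + 1 := by
      conv_lhs => rw [hd]
      simp
    simp [hi, this]
  · simp [hi]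

theorem homogeneousComponent_zero_X_mul (i : σ) (p : MvPolynomial σ k) :
    homogeneousComponent 0 (X i * p) = 0 := by
  classical
  simp [homogeneousComponent_zero, coeff_X_mul']

end LeadingForms

/-! ### The graded annihilator -/

/-- Cramer's rule: multiply the relations by the adjugate matrix. -/
theorem Matrix.det_smul_eq_zero {R N ι : Type*} [CommRing R] [AddCommGroup N] [Module R N]
    [Fintype ι] [DecidableEq ι] (P : Matrix ι ι R) (y : ι → N)
    (h : ∀ i, ∑ j, P i j • y j = 0) (j : ι) : P.det • y j = 0 := by
  have h1 : ∑ i, ∑ l, (P.adjugate j i * P i l) • y l = 0 := by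
    refine Finset.sum_eq_zero fun i _ => ?_
    simp_rw [mul_smul, ← Finset.smul_sum, h i, smul_zero]
  rw [Finset.sum_comm] at h1
  simp_rw [← Finset.sum_smul, ← Matrix.mul_apply, Matrix.adjugate_mul] at h1
  simpa [Matrix.one_apply, Finset.sum_ite_eq, ite_smul] using h1

section GradedAnnihilator

open MvPolynomial

variable {k : Type*} [Field k] {n : ℕ} {N : Type*} [AddCommGroup N]
  [Module (MvPolynomial (Fin n) k) N]

theorem smul_mem_orderFiltration {S : Set N} {e : ℕ} {P : MvPolynomial (Fin n) k}
    (hP : P ∈ degreeLT k (Fin n) e) {q : ℤ} {x : N} (hx : x ∈ orderFiltration k n S q) :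
    P • x ∈ orderFiltration k n S (q + e - 1) := by
  cases e with
  | zero =>
    rw [degreeLT_zero, Submodule.mem_bot] at hP
    simp [hP, zero_mem]
  | succ e =>
    rw [mem_degreeLT_succ] at hP
    induction hx using AddSubgroup.closure_induction with
    | mem x hx =>
      obtain ⟨Q, hQ, s, hs, rfl⟩ := hx
      refine AddSubgroup.subset_closure ⟨P * Q, ?_, s, hs, by rw [mul_smul]⟩
      have := totalDegree_mul P Q
      push_cast
      omega
    | zero => simp [zero_mem]
    | add x y _ _ hx hy => simpa [smul_add] using add_mem hx hy
    | neg x _ hx => simpa [smul_neg] using hx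

theorem exists_of_mem_orderFiltration {S : Finset N} {e : ℕ} {x : N}
    (hx : x ∈ orderFiltration k n (S : Set N) (e - 1)) :
    ∃ Q : S → MvPolynomial (Fin n) k, (∀ s, Q s ∈ degreeLT k (Fin n) e) ∧
      x = ∑ s, Q s • (s : N) := by
  classical
  induction hx using AddSubgroup.closure_induction with
  | mem x hx =>
    obtain ⟨P, hP, s, hs, rfl⟩ := hx
    refine ⟨Pi.single ⟨s, hs⟩ P, fun t => ?_, ?_⟩
    · obtain ⟨e, rfl⟩ : ∃ e', e = e' + 1 := ⟨e - 1, by omega⟩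
      by_cases ht : t = ⟨s, hs⟩
      · subst ht
        rw [Pi.single_eq_same, mem_degreeLT_succ]
        push_cast at hP
        omega
      · rw [Pi.single_eq_of_ne ht]
        exact zero_mem _
    · rw [Finset.sum_eq_single ⟨s, hs⟩]
      · simp
      · intro t _ ht
        simp [Pi.single_eq_of_ne ht]
      · simp
  | zero => exact ⟨0, fun _ => zero_mem _, by simp⟩
  | add x y _ _ hx hy =>
    obtain ⟨Q, hQ, rfl⟩ := hx
    obtain ⟨R, hR, rfl⟩ := hy
    exact ⟨Q + R, fun s => add_mem (hQ s) (hR s), by simp [add_smul, Finset.sum_add_distrib]⟩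
  | neg x _ hx =>
    obtain ⟨Q, hQ, rfl⟩ := hx
    exact ⟨-Q, fun s => neg_mem (hQ s), by simp [neg_smul]⟩

/-- Since `P` acts as zero, `f` acts as `-(P - f)`, which has degree less than `e`. -/
theorem IsLeadingForm.mem_gradedAnnihilator {e : ℕ} {f P : MvPolynomial (Fin n) k}
    (h : IsLeadingForm e f P) (hP : P ∈ Module.annihilator (MvPolynomial (Fin n) k) N)
    (S : Set N) : f ∈ gradedAnnihilator k n S := by
  refine Ideal.subset_span ⟨e, h.1, fun q x hx => ?_⟩
  have h1 := neg_mem (smul_mem_orderFiltration h.2 hx)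
  rwa [sub_smul, Module.mem_annihilator.1 hP x, zero_sub, neg_neg] at h1

theorem IsLeadingForm.mem_characteristicIdeal {e : ℕ} {f P : MvPolynomial (Fin n) k}
    (h : IsLeadingForm e f P) (hP : P ∈ Module.annihilator (MvPolynomial (Fin n) k) N) :
    f ∈ characteristicIdeal k n N := by
  simp only [characteristicIdeal, Submodule.mem_iInf]
  exact fun S _ => Ideal.le_radical (h.mem_gradedAnnihilator hP S)

theorem homogeneousComponent_smul_mem_orderFiltration {S : Set N} {P : MvPolynomial (Fin n) k}
    (hP : P ∈ gradedAnnihilator k n S) (e : ℕ) {q : ℤ} {x : N}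
    (hx : x ∈ orderFiltration k n S q) :
    homogeneousComponent e P • x ∈ orderFiltration k n S (q + e - 1) := by
  induction hP using Submodule.span_induction generalizing e q x with
  | mem P hP =>
    obtain ⟨d, hd, h⟩ := hP
    rw [homogeneousComponent_of_mem hd]
    split_ifs with hed
    · subst hed
      exact h q x hx
    · simp [zero_mem]
  | zero => simp [zero_mem]
  | add P Q _ _ hP hQ => simpa [add_smul] using add_mem (hP e hx) (hQ e hx)
  | smul a P _ hP =>
    rw [smul_eq_mul]
    induction a using MvPolynomial.induction_on generalizing e q x with
    | C c =>
      rw [homogeneousComponent_C_mul, mul_comm, mul_smul]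
      refine hP e ?_
      have hc : (C c : MvPolynomial (Fin n) k) ∈ degreeLT k (Fin n) 1 := by
        rw [mem_degreeLT_succ]; simp
      simpa using smul_mem_orderFiltration hc hx
    | add a b ha hb => simpa [add_mul, add_smul] using add_mem (ha e hx) (hb e hx)
    | mul_X a i ha =>
      have hr : a * X i * P = X i * (a * P) := by ring
      rw [hr]
      cases e with
      | zero => rw [homogeneousComponent_zero_X_mul, zero_smul]; exact zero_mem _
      | succ e =>
        rw [homogeneousComponent_X_mul, mul_smul]
        have hX : (X i : MvPolynomial (Fin n) k) ∈ degreeLT k (Fin n) 2 := by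
          rw [mem_degreeLT_succ]; simp
        have := smul_mem_orderFiltration hX (ha e hx)
        convert this using 2
        push_cast
        ring

/-- Every form in the graded annihilator has a power which is the leading form of an element of
the annihilator. -/
theorem exists_isLeadingForm_pow_of_mem_gradedAnnihilator {S : Finset N}
    (hS : Submodule.span (MvPolynomial (Fin n) k) (S : Set N) = ⊤) {e : ℕ}
    {f : MvPolynomial (Fin n) k} (hf : f.IsHomogeneous e)
    (hfS : f ∈ gradedAnnihilator k n (S : Set N)) :
    ∃ (d : ℕ) (P : MvPolynomial (Fin n) k), P ∈ Module.annihilator (MvPolynomial (Fin n) k) N ∧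
      IsLeadingForm (d * e) (f ^ d) P := by
  classical
  have h0 : ∀ s : S, ∃ Q : S → MvPolynomial (Fin n) k, (∀ t, Q t ∈ degreeLT k (Fin n) e) ∧
      f • (s : N) = ∑ t, Q t • (t : N) := by
    intro s
    have hs : (s : N) ∈ orderFiltration k n (S : Set N) 0 :=
      AddSubgroup.subset_closure ⟨1, by simp, s, s.2, by simp⟩
    have h := homogeneousComponent_smul_mem_orderFiltration hfS e hs
    rw [homogeneousComponent_eq_self hf, zero_add] at h
    exact exists_of_mem_orderFiltration h
  choose Q hQ hfQ using h0
  -- Determinant trick: `f - Q` kills the vector of generators and the entries of `Q` have degree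
  -- less than `e`, so the determinant kills `N` and has leading form `f ^ |S|`.
  let P : Matrix S S (MvPolynomial (Fin n) k) := Matrix.scalar S f - Matrix.of Q
  have hP : ∀ s : S, ∑ t, P s t • (t : N) = 0 := by
    intro s
    simp only [P, Matrix.sub_apply, Matrix.of_apply, sub_smul, Finset.sum_sub_distrib, ← hfQ]
    simp [Matrix.diagonal_apply, ite_smul]
  refine ⟨Fintype.card S, P.det, ?_, ?_⟩
  · have hle : (⊤ : Submodule (MvPolynomial (Fin n) k) N) ≤
        LinearMap.ker (LinearMap.lsmul (MvPolynomial (Fin n) k) N P.det) := by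
      rw [← hS, Submodule.span_le]
      exact fun s hs => Matrix.det_smul_eq_zero P (fun t : S => (t : N)) hP ⟨s, hs⟩
    exact Module.mem_annihilator.2 fun x => hle (Submodule.mem_top (x := x))
  · have hdet : f ^ Fintype.card S = (Matrix.scalar S f).det := by simp
    rw [hdet]
    refine IsLeadingForm.det fun s t => ⟨?_, ?_⟩
    · by_cases hst : s = t
      · simpa [hst] using hf
      · simpa [hst] using isHomogeneous_zero _ _ _
    · simpa [P] using hQ s t

end GradedAnnihilator

/-! ### Triangular ideals and the dimension of the characteristic variety -/

section Triangular

open MvPolynomial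

variable {k : Type*} [Field k] {n : ℕ}

/-- The matrix `X h + B + B₀` where `B` has the linear forms `∑ l, b i j l * X l` as entries. -/
noncomputable def linearMatrix {m : ℕ} (h : Fin n) (b : Fin m → Fin m → Fin n → k)
    (b₀ : Fin m → Fin m → k) : Matrix (Fin m) (Fin m) (MvPolynomial (Fin n) k) :=
  Matrix.scalar (Fin m) (X h) +
    Matrix.of fun i j => ∑ l, C (b i j l) * X l + C (b₀ i j)

/-- For every `h ≥ s`, the ideal contains a polynomial `det (X h + B + B₀)` where the entries of `B`
are linear forms in the variables before `X h`, and those of `B₀` are constants. -/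
def IsTriangular (s : ℕ) (I : Ideal (MvPolynomial (Fin n) k)) : Prop :=
  ∀ h : Fin n, s ≤ h → ∃ (m : ℕ) (b : Fin m → Fin m → Fin n → k) (b₀ : Fin m → Fin m → k),
    (∀ i j l, h ≤ l → b i j l = 0) ∧ (linearMatrix h b b₀).det ∈ I

theorem IsTriangular.mono {s : ℕ} {I J : Ideal (MvPolynomial (Fin n) k)} (hI : IsTriangular s I)
    (hIJ : I ≤ J) : IsTriangular s J := fun h hs =>
  let ⟨m, b, b₀, hb, hdet⟩ := hI h hs
  ⟨m, b, b₀, hb, hIJ hdet⟩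

theorem isLeadingForm_linearMatrix_det {m : ℕ} (h : Fin n) (b : Fin m → Fin m → Fin n → k)
    (b₀ : Fin m → Fin m → k) :
    IsLeadingForm (m * 1) (linearMatrix h b 0).det (linearMatrix h b b₀).det := by
  have := IsLeadingForm.det (e := 1) (F := linearMatrix h b 0) (P := linearMatrix h b b₀) ?_
  · simpa using this
  · intro i j
    refine ⟨?_, ?_⟩
    · simp only [linearMatrix, Matrix.add_apply, Matrix.of_apply, Pi.zero_apply, map_zero, add_zero]
      refine IsHomogeneous.add ?_ ?_
      · by_cases hij : i = j
        · simpa [hij] using isHomogeneous_X k h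
        · simpa [hij] using isHomogeneous_zero _ _ _
      · exact IsHomogeneous.sum _ _ _ fun l _ => isHomogeneous_C_mul_X _ _
    · simp only [linearMatrix, Matrix.add_apply, Matrix.of_apply, Pi.zero_apply, map_zero, add_zero,
        add_sub_add_left_eq_sub, add_sub_cancel_left]
      rw [mem_degreeLT_succ]
      simp

theorem IsTriangular.isTriangular_characteristicIdeal {s : ℕ} {N : Type*} [AddCommGroup N]
    [Module (MvPolynomial (Fin n) k) N]
    (hI : IsTriangular s (Module.annihilator (MvPolynomial (Fin n) k) N)) :
    IsTriangular s (characteristicIdeal k n N) := fun h hs =>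
  let ⟨m, b, b₀, hb, hdet⟩ := hI h hs
  ⟨m, b, 0, hb, (isLeadingForm_linearMatrix_det h b b₀).mem_characteristicIdeal hdet⟩

variable (k) in
/-- The inclusion of the ring of polynomials in the first `s` variables, followed by the reduction
modulo an ideal. -/
noncomputable def renameMk {s : ℕ} (hs : s ≤ n) (I : Ideal (MvPolynomial (Fin n) k)) :
    MvPolynomial (Fin s) k →+* MvPolynomial (Fin n) k ⧸ I :=
  (Ideal.Quotient.mk I).comp (rename (R := k) (Fin.castLE hs)).toRingHom

@[simp]
theorem renameMk_apply {s : ℕ} (hs : s ≤ n) (I : Ideal (MvPolynomial (Fin n) k))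
    (p : MvPolynomial (Fin s) k) :
    renameMk k hs I p = Ideal.Quotient.mk I (rename (Fin.castLE hs) p) := rfl

/-- Induction on the index of the variable: for `h ≥ s` the determinant makes `X h` integral over
the earlier variables. -/
theorem IsTriangular.isIntegral {s : ℕ} (hs : s ≤ n) {I : Ideal (MvPolynomial (Fin n) k)}
    (hI : IsTriangular s I) : (renameMk k hs I).IsIntegral := by
  have hC (c : k) : (Ideal.Quotient.mk I (C c)) ∈ (renameMk k hs I).integralSubring := by
    have := (renameMk k hs I).map_mem_integralSubring (C c)
    simpa using this
  have hX : ∀ (d : ℕ) (h : Fin n), (h : ℕ) = d →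
      (Ideal.Quotient.mk I (X h)) ∈ (renameMk k hs I).integralSubring := by
    intro d
    induction d using Nat.strong_induction_on with
    | _ d ih =>
      intro h hd
      by_cases hsh : s ≤ h
      · obtain ⟨m, b, b₀, hb, hdet⟩ := hI h hsh
        rw [← Ideal.Quotient.eq_zero_iff_mem, RingHom.map_det] at hdet
        refine RingHom.mem_integralSubring_of_det_eq_zero _ _
          (Matrix.of fun i j => Ideal.Quotient.mk I (∑ l, C (b i j l) * X l + C (b₀ i j)))
          (fun i j => ?_) ?_
        · simp only [Matrix.of_apply, map_add, map_sum, map_mul]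
          refine add_mem ?_ (hC _)
          refine sum_mem fun l _ => ?_
          by_cases hl : h ≤ l
          · simp [hb i j l hl, zero_mem]
          · exact mul_mem (hC _) (ih l (by omega) l rfl)
        · convert hdet using 2
          ext i j
          by_cases hij : i = j <;> simp [linearMatrix, hij]
      · have := (renameMk k hs I).map_mem_integralSubring (X ⟨h, by omega⟩)
        simpa using this
  intro x
  rw [← RingHom.mem_integralSubring]
  obtain ⟨p, rfl⟩ := Ideal.Quotient.mk_surjective x
  induction p using MvPolynomial.induction_on with
  | C c => exact hC c
  | add p q hp hq => rw [map_add]; exact add_mem hp hq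
  | mul_X p i hp => rw [map_mul]; exact mul_mem hp (hX _ i rfl)

/-! #### Rees algebras -/

variable (k) in
/-- The Rees algebra of the ring of polynomials in `s` variables, filtered by the degree. -/
noncomputable def reesSubring (s : ℕ) : Subring (Polynomial (MvPolynomial (Fin s) k)) where
  carrier := {p | ∀ e, p.coeff e ∈ degreeLT k (Fin s) (e + 1)}
  mul_mem' {p q} hp hq e := by
    rw [Polynomial.coeff_mul]
    refine sum_mem fun x hx => mul_mem_degreeLT (hp x.1) (hq x.2) ?_
    have := Finset.HasAntidiagonal.mem_antidiagonal.1 hx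
    omega
  one_mem' e := by
    rw [Polynomial.coeff_one, mem_degreeLT_succ]
    split_ifs <;> simp
  add_mem' {p q} hp hq e := by
    rw [Polynomial.coeff_add]
    exact add_mem (hp e) (hq e)
  zero_mem' e := by simp [zero_mem]
  neg_mem' {p} hp e := by
    rw [Polynomial.coeff_neg]
    exact neg_mem (hp e)

theorem mem_reesSubring {s : ℕ} {p : Polynomial (MvPolynomial (Fin s) k)} :
    p ∈ reesSubring k s ↔ ∀ e, p.coeff e ∈ degreeLT k (Fin s) (e + 1) := Iff.rfl

theorem monomial_mem_reesSubring {s e : ℕ} {p : MvPolynomial (Fin s) k}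
    (hp : p ∈ degreeLT k (Fin s) (e + 1)) : Polynomial.monomial e p ∈ reesSubring k s := by
  intro d
  rw [Polynomial.coeff_monomial]
  split_ifs with h
  · exact h ▸ hp
  · exact zero_mem _

/-- The map from the Rees algebra of the ring of polynomials in the first `s` variables. -/
noncomputable def reesMap {s : ℕ} (hs : s ≤ n) (I : Ideal (MvPolynomial (Fin n) k)) :
    reesSubring k s →+* Polynomial (MvPolynomial (Fin n) k ⧸ I) :=
  (Polynomial.mapRingHom (renameMk k hs I)).comp (reesSubring k s).subtype

theorem monomial_mem_integralSubring_reesMap {s : ℕ} (hs : s ≤ n) (I : Ideal (MvPolynomial (Fin n) k))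
    {e : ℕ} {p : MvPolynomial (Fin s) k} (hp : p ∈ degreeLT k (Fin s) (e + 1)) :
    (Polynomial.monomial e (Ideal.Quotient.mk I (rename (Fin.castLE hs) p))) ∈ (reesMap hs I).integralSubring := by
  have := RingHom.map_mem_integralSubring (A := reesSubring k s)
    (R := Polynomial (MvPolynomial (Fin n) k ⧸ I)) (reesMap hs I) ⟨_, monomial_mem_reesSubring hp⟩
  simpa [reesMap] using this

/-- The induction of `IsTriangular.isIntegral`, with the degree recorded by the exponent of the Rees
variable `T`. -/
theorem IsTriangular.mem_integralSubring_reesMap {s : ℕ} (hs : s ≤ n)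
    {I : Ideal (MvPolynomial (Fin n) k)} (hI : IsTriangular s I) {e : ℕ}
    {p : MvPolynomial (Fin n) k} (hp : p ∈ degreeLT k (Fin n) (e + 1)) :
    Polynomial.monomial e (Ideal.Quotient.mk I p) ∈ (reesMap hs I).integralSubring := by
  have hC (d : ℕ) (c : k) :
      (Polynomial.monomial d (Ideal.Quotient.mk I (C c))) ∈ (reesMap hs I).integralSubring := by
    have hc : (C c : MvPolynomial (Fin s) k) ∈ degreeLT k (Fin s) (d + 1) := by
      rw [mem_degreeLT_succ]; simp
    simpa using monomial_mem_integralSubring_reesMap hs I hc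
  have hX : ∀ (d : ℕ) (h : Fin n), (h : ℕ) = d →
      (Polynomial.monomial 1 (Ideal.Quotient.mk I (X h))) ∈ (reesMap hs I).integralSubring := by
    intro d
    induction d using Nat.strong_induction_on with
    | _ d ih =>
      intro h hd
      by_cases hsh : s ≤ h
      · obtain ⟨m, b, b₀, hb, hdet⟩ := hI h hsh
        refine RingHom.mem_integralSubring_of_det_eq_zero _ _
          (Matrix.of fun i j => Polynomial.monomial 1
            (Ideal.Quotient.mk I (∑ l, C (b i j l) * X l + C (b₀ i j))))
          (fun i j => ?_) ?_
        · simp only [Matrix.of_apply, map_add, map_sum]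
          refine add_mem ?_ (hC _ _)
          refine sum_mem fun l _ => ?_
          by_cases hl : h ≤ l
          · simp [hb i j l hl, zero_mem]
          · have := mul_mem (hC 0 (b i j l)) (ih l (by omega) l rfl)
            rwa [Polynomial.monomial_mul_monomial, zero_add, ← map_mul] at this
        -- The matrix is `T` times `linearMatrix h b b₀`, so its determinant is `T ^ m` times an
        -- element of `I`.
        · have hM : Matrix.scalar (Fin m) (Polynomial.monomial 1 (Ideal.Quotient.mk I (X h))) +
              (Matrix.of fun i j => Polynomial.monomial 1
                (Ideal.Quotient.mk I (∑ l, C (b i j l) * X l + C (b₀ i j)))) =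
              (Polynomial.X : Polynomial (MvPolynomial (Fin n) k ⧸ I)) •
                (Polynomial.C.comp (Ideal.Quotient.mk I)).mapMatrix (linearMatrix h b b₀) := by
            refine Matrix.ext fun i j => ?_
            rw [Matrix.smul_apply, RingHom.mapMatrix_apply, Matrix.map_apply, Matrix.add_apply,
              Matrix.of_apply, smul_eq_mul, RingHom.comp_apply, Polynomial.X_mul_C,
              Polynomial.C_mul_X_eq_monomial]
            by_cases hij : i = j <;> simp [linearMatrix, hij]
          rw [hM, Matrix.det_smul, ← RingHom.map_det, RingHom.comp_apply,
            Ideal.Quotient.eq_zero_iff_mem.2 hdet, map_zero, mul_zero]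
      · have hX' : (X ⟨h, by omega⟩ : MvPolynomial (Fin s) k) ∈ degreeLT k (Fin s) (1 + 1) := by
          rw [mem_degreeLT_succ]; simp
        simpa using monomial_mem_integralSubring_reesMap hs I hX'
  have hmon : ∀ (d : Fin n →₀ ℕ) (c : k) (e : ℕ), d.degree ≤ e →
      (Polynomial.monomial e (Ideal.Quotient.mk I (monomial d c))) ∈ (reesMap hs I).integralSubring := by
    intro d c
    induction d using Finsupp.induction_linear generalizing c with
    | zero => exact fun e _ => hC e c
    | add d₁ d₂ h₁ h₂ =>
      intro e he
      rw [map_add] at he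
      have := mul_mem (h₁ 1 _ le_rfl) (h₂ c (e - d₁.degree) (by omega))
      rwa [Polynomial.monomial_mul_monomial, ← map_mul, monomial_mul, one_mul,
        Nat.add_sub_of_le (by omega)] at this
    | single i a =>
      intro e he
      rw [Finsupp.degree_single] at he
      have h1 := mul_mem (hC (e - a) c)
        (pow_mem (hX _ i rfl) a)
      rw [Polynomial.monomial_pow, one_mul, Polynomial.monomial_mul_monomial, ← map_pow, ← map_mul,
        Nat.sub_add_cancel he] at h1
      rwa [monomial_eq, Finsupp.prod_single_index (by simp)]
  rw [p.as_sum, map_sum, map_sum]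
  refine sum_mem fun d hd => hmon d _ e ?_
  by_contra hlt
  exact (mem_support_iff.1 hd) (hp d (by omega))

end Triangular

/-! ### Independent variables and bounds for the codimension -/

section Dimension

open MvPolynomial

variable {k : Type*} [Field k] {n : ℕ}

/-- Scaling the roots by `t` multiplies every coefficient but the leading one by a positive power of
`t`. -/
theorem Polynomial.Monic.dvd_eval_scaleRoots_sub_pow {R : Type*} [CommRing R] {p : Polynomial R}
    (hp : p.Monic) (t x : R) : t ∣ (p.scaleRoots t).eval x - x ^ p.natDegree := by
  rw [Polynomial.eval_eq_sum_range, Polynomial.natDegree_scaleRoots, Finset.sum_range_succ,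
    Polynomial.coeff_scaleRoots_natDegree, hp.leadingCoeff, one_mul, add_sub_cancel_right]
  refine Finset.dvd_sum fun i hi => ?_
  rw [Polynomial.coeff_scaleRoots]
  refine Dvd.dvd.mul_right (Dvd.dvd.mul_left (dvd_pow_self t ?_) _) _
  have := Finset.mem_range.1 hi
  omega

/-- If the first `s` variables are independent modulo a triangular ideal `I`, then no form in these
variables is the leading form of an element of `I`. -/
theorem IsTriangular.eq_zero_of_isLeadingForm {s : ℕ} (hs : s ≤ n)
    {I : Ideal (MvPolynomial (Fin n) k)} (hI : IsTriangular s I)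
    (hinj : Function.Injective (renameMk k hs I)) {e : ℕ} {f : MvPolynomial (Fin s) k}
    (hf : f.IsHomogeneous e) {P : MvPolynomial (Fin n) k} (hP : P ∈ I)
    (h : IsLeadingForm e (rename (Fin.castLE hs) f) P) : f = 0 := by
  have hmk : Ideal.Quotient.mk I (rename (Fin.castLE hs) f - P) = renameMk k hs I f := by
    rw [map_sub, Ideal.Quotient.eq_zero_iff_mem.2 hP, sub_zero, renameMk_apply]
  have hmem : rename (Fin.castLE hs) f - P ∈ degreeLT k (Fin n) e := by
    rw [← neg_sub]
    exact neg_mem h.2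
  cases e with
  | zero =>
    rw [degreeLT_zero, Submodule.mem_bot] at hmem
    rw [hmem, map_zero] at hmk
    exact hinj (by rw [← hmk, map_zero])
  | succ e =>
    -- Here `F = f T^(e+1)` and `t = T`. Modulo `I`, `f` equals `f - P` of degree at most `e`, so
    -- already `f T^e` is integral over the Rees algebra. Scaling the roots of its equation by `t`
    -- shows that `t` divides a power of `F`, so that a power of `f` has smaller degree than it
    -- should.
    let F : reesSubring k s := ⟨_, monomial_mem_reesSubring hf.mem_degreeLT⟩
    have ht : (1 : MvPolynomial (Fin s) k) ∈ degreeLT k (Fin s) (1 + 1) := by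
      rw [mem_degreeLT_succ]; simp
    let t : reesSubring k s := ⟨_, monomial_mem_reesSubring ht⟩
    obtain ⟨p, hp, hp0⟩ := (RingHom.mem_integralSubring _).1
      (IsTriangular.mem_integralSubring_reesMap hs hI hmem)
    have hF : reesMap hs I t * Polynomial.monomial e
        (Ideal.Quotient.mk I (rename (Fin.castLE hs) f - P)) = reesMap hs I F := by
      rw [hmk]
      simp [reesMap, t, F, Polynomial.monomial_mul_monomial, add_comm]
    have h1 := Polynomial.scaleRoots_eval₂_eq_zero (S := reesSubring k s)
      (R := Polynomial (MvPolynomial (Fin n) k ⧸ I)) (s := t) (reesMap hs I) hp0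
    rw [hF, Polynomial.eval₂_at_apply] at h1
    have hφ : Function.Injective (reesMap hs I) :=
      (Polynomial.map_injective _ hinj).comp Subtype.val_injective
    have h2 : (p.scaleRoots t).eval F = 0 := hφ (by rw [h1, map_zero])
    have h3 := hp.dvd_eval_scaleRoots_sub_pow t F
    rw [h2, zero_sub, dvd_neg] at h3
    obtain ⟨u, hu⟩ := h3
    have h4 : (Polynomial.monomial (e + 1) f) ^ p.natDegree =
        Polynomial.monomial 1 1 * (u : Polynomial (MvPolynomial (Fin s) k)) :=
      congrArg Subtype.val hu
    have h5 : f ^ p.natDegree ∈ degreeLT k (Fin s) ((e + 1) * p.natDegree) := by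
      have h6 := congrArg (fun q => Polynomial.coeff q ((e + 1) * p.natDegree)) h4
      simp only [Polynomial.monomial_pow, Polynomial.coeff_monomial_same] at h6
      rw [h6, Polynomial.monomial_one_one_eq_X]
      generalize (e + 1) * p.natDegree = d
      cases d with
      | zero => simp [zero_mem]
      | succ d =>
        rw [Polynomial.coeff_X_mul]
        exact mem_reesSubring.1 u.2 d
    exact eq_zero_of_pow_eq_zero ((hf.pow _).eq_zero_of_mem_degreeLT h5)

variable {N : Type*} [AddCommGroup N] [Module (MvPolynomial (Fin n) k) N]

variable (k n N) in
/-- No nonzero polynomial in the first `s` variables annihilates `x`. -/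
def IsFreeElement {s : ℕ} (hs : s ≤ n) (x : N) : Prop :=
  ∀ p : MvPolynomial (Fin s) k, rename (Fin.castLE hs) p • x = 0 → p = 0

/-- If `f` is in the kernel, each form of some power of `f` lies in the graded annihilator, so a
power of that form is the leading form of an element of the annihilator and
`IsTriangular.eq_zero_of_isLeadingForm` applies. -/
theorem IsTriangular.injective_renameMk {s : ℕ} (hs : s ≤ n)
    (hN : IsTriangular s (Module.annihilator (MvPolynomial (Fin n) k) N))
    [Module.Finite (MvPolynomial (Fin n) k) N] {x : N} (hx : IsFreeElement k n N hs x) :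
    Function.Injective (renameMk k hs (characteristicIdeal k n N)) := by
  obtain ⟨S, hS⟩ := Module.Finite.fg_top (R := MvPolynomial (Fin n) k) (M := N)
  have hinj : Function.Injective
      (renameMk k hs (Module.annihilator (MvPolynomial (Fin n) k) N)) := by
    refine (injective_iff_map_eq_zero _).2 fun p hp => ?_
    rw [renameMk_apply, Ideal.Quotient.eq_zero_iff_mem, Module.mem_annihilator] at hp
    exact hx p (hp x)
  refine (injective_iff_map_eq_zero _).2 fun f hf => ?_
  rw [renameMk_apply, Ideal.Quotient.eq_zero_iff_mem] at hf
  have hrad : rename (Fin.castLE hs) f ∈ (gradedAnnihilator k n (S : Set N)).radical := by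
    simp only [characteristicIdeal, Submodule.mem_iInf] at hf
    exact hf S hS
  obtain ⟨a, ha⟩ := hrad
  rw [← map_pow] at ha
  by_contra hne
  obtain ⟨g, hg⟩ : ∃ g, g = f ^ a := ⟨_, rfl⟩
  have hg0 : g ≠ 0 := hg ▸ pow_ne_zero a hne
  rw [← hg] at ha
  refine hg0 ?_
  rw [← sum_homogeneousComponent g]
  refine Finset.sum_eq_zero fun e _ => ?_
  have hmem : rename (Fin.castLE hs) (homogeneousComponent e g) ∈
      gradedAnnihilator k n (S : Set N) := by
    rw [rename_homogeneousComponent]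
    refine Ideal.subset_span ⟨e, homogeneousComponent_isHomogeneous _ _, fun q y hy => ?_⟩
    exact homogeneousComponent_smul_mem_orderFiltration ha e hy
  have hhom : (homogeneousComponent e g).IsHomogeneous e := homogeneousComponent_isHomogeneous _ _
  obtain ⟨d, P, hP, hlead⟩ :=
    exists_isLeadingForm_pow_of_mem_gradedAnnihilator hS hhom.rename_isHomogeneous hmem
  rw [← map_pow] at hlead
  rw [mul_comm] at hlead
  exact eq_zero_of_pow_eq_zero (hN.eq_zero_of_isLeadingForm hs hinj (hhom.pow d) hP hlead)

theorem ringKrullDim_mvPolynomial_fin (s : ℕ) : ringKrullDim (MvPolynomial (Fin s) k) = s := by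
  simp

/-- Finiteness over the polynomials in `s` variables bounds the dimension from above. -/
theorem IsTriangular.le_codim {s : ℕ} (hs : s ≤ n)
    (hN : IsTriangular s (Module.annihilator (MvPolynomial (Fin n) k) N)) :
    ((n - s : ℕ) : ℕ∞) ≤ codim k n N := by
  have h := ringKrullDim_le_of_isIntegral _ (hN.isTriangular_characteristicIdeal.isIntegral hs)
  rw [ringKrullDim_mvPolynomial_fin] at h
  unfold codim
  generalize ringKrullDim (MvPolynomial (Fin n) k ⧸ characteristicIdeal k n N) = d at h
  induction d using WithBot.recBotCoe with
  | bot => exact le_top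
  | coe d =>
    have h' : d ≤ (s : ℕ∞) := WithBot.coe_le_coe.1 h
    simpa using tsub_le_tsub_left h' (n : ℕ∞)

theorem IsTriangular.lt_codim {s : ℕ} (hs : s ≤ n)
    (hN : IsTriangular s (Module.annihilator (MvPolynomial (Fin n) k) N))
    {p : MvPolynomial (Fin s) k} (hp : p ≠ 0)
    (hpN : rename (Fin.castLE hs) p ∈ Module.annihilator (MvPolynomial (Fin n) k) N) :
    ((n - s : ℕ) : ℕ∞) < codim k n N := by
  have hlead : IsLeadingForm p.totalDegree
      (rename (Fin.castLE hs) (homogeneousComponent p.totalDegree p))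
      (rename (Fin.castLE hs) p) := by
    rw [rename_homogeneousComponent]
    refine isLeadingForm_homogeneousComponent ?_
    rw [mem_degreeLT_succ]
    exact totalDegree_rename_le _ _
  have hne : homogeneousComponent p.totalDegree p ≠ 0 := by
    intro h0
    have h1 := isLeadingForm_homogeneousComponent (mem_degreeLT_succ.2 (le_refl p.totalDegree))
    have h2 := h1.2
    rw [h0, sub_zero] at h2
    cases hd : p.totalDegree with
    | zero =>
      rw [hd, degreeLT_zero, Submodule.mem_bot] at h2
      exact hp h2
    | succ d =>
      rw [hd, mem_degreeLT_succ] at h2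
      omega
  have h := ringKrullDim_succ_le_of_isIntegral _ (hN.isTriangular_characteristicIdeal.isIntegral hs)
    (mem_nonZeroDivisors_of_ne_zero hne) (by
      rw [renameMk_apply, Ideal.Quotient.eq_zero_iff_mem]
      exact hlead.mem_characteristicIdeal hpN)
  rw [ringKrullDim_mvPolynomial_fin] at h
  unfold codim
  generalize ringKrullDim (MvPolynomial (Fin n) k ⧸ characteristicIdeal k n N) = d at h
  induction d using WithBot.recBotCoe with
  -- Empty characteristic variety: the codimension is `⊤`.
  | bot => exact ENat.natCast_lt_top _
  | coe d =>
    have h' : d + 1 ≤ (s : ℕ∞) := WithBot.coe_le_coe.1 h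
    lift d to ℕ using (((self_le_add_right d 1).trans h').trans_lt
      (ENat.natCast_lt_top s)).ne
    have h'' : d + 1 ≤ s := by exact_mod_cast h'
    change ((n - s : ℕ) : ℕ∞) < (n : ℕ∞) - (d : ℕ∞)
    exact_mod_cast (by omega : n - s < n - d)

theorem IsTriangular.codim_le {s : ℕ} (hs : s ≤ n)
    (hN : IsTriangular s (Module.annihilator (MvPolynomial (Fin n) k) N))
    [Module.Finite (MvPolynomial (Fin n) k) N] {x : N} (hx : IsFreeElement k n N hs x) :
    codim k n N ≤ ((n - s : ℕ) : ℕ∞) := by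
  have h := ringKrullDim_le_of_isIntegral_of_injective _ (hN.isTriangular_characteristicIdeal.isIntegral hs)
    (hN.injective_renameMk hs hx)
  rw [ringKrullDim_mvPolynomial_fin] at h
  unfold codim
  generalize ringKrullDim (MvPolynomial (Fin n) k ⧸ characteristicIdeal k n N) = d at h
  induction d using WithBot.recBotCoe with
  | bot =>
    exact absurd (le_bot_iff.1 h) (by simp)
  | coe d =>
    have h' : (s : ℕ∞) ≤ d := WithBot.coe_le_coe.1 h
    simpa using tsub_le_tsub_left h' (n : ℕ∞)

/-! #### Cyclic submodules -/

theorem IsTriangular.span_singleton {s : ℕ}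
    (hN : IsTriangular s (Module.annihilator (MvPolynomial (Fin n) k) N)) (x : N) :
    IsTriangular s (Module.annihilator (MvPolynomial (Fin n) k)
      (Submodule.span (MvPolynomial (Fin n) k) {x})) :=
  hN.mono (LinearMap.annihilator_le_of_injective
    (Submodule.span (MvPolynomial (Fin n) k) {x}).subtype Subtype.val_injective)

theorem IsTriangular.le_codim_span {s : ℕ} (hs : s ≤ n)
    (hN : IsTriangular s (Module.annihilator (MvPolynomial (Fin n) k) N)) (x : N) :
    ((n - s : ℕ) : ℕ∞) ≤ codim k n (Submodule.span (MvPolynomial (Fin n) k) {x}) :=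
  (hN.span_singleton x).le_codim hs

/-- The cyclic submodule generated by `x` has codimension greater than `n - s` if and only if `x`
is a torsion element over the polynomials in the first `s` variables. -/
theorem IsTriangular.lt_codim_span_iff {s : ℕ} (hs : s ≤ n)
    (hN : IsTriangular s (Module.annihilator (MvPolynomial (Fin n) k) N)) (x : N) :
    ((n - s : ℕ) : ℕ∞) < codim k n (Submodule.span (MvPolynomial (Fin n) k) {x}) ↔
      ¬ IsFreeElement k n N hs x := by
  constructor
  · intro h hx
    refine h.not_ge ((hN.span_singleton x).codim_le hs
      (x := ⟨x, Submodule.mem_span_singleton_self x⟩) fun p hp => hx p ?_)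
    simpa using congrArg Subtype.val hp
  · intro h
    simp only [IsFreeElement, not_forall] at h
    obtain ⟨p, hpx, hp⟩ := h
    refine (hN.span_singleton x).lt_codim hs hp ?_
    rw [Module.mem_annihilator]
    rintro ⟨y, hy⟩
    obtain ⟨a, rfl⟩ := Submodule.mem_span_singleton.1 hy
    ext
    change rename (Fin.castLE hs) p • a • x = 0
    rw [smul_comm, hpx, smul_zero]

end Dimension

/-! ### Involutive systems -/

section Involution

open MvPolynomial

section

variable {k : Type*} [Field k] {σ : Type*}

theorem mem_supported_iff_degreeOf {s : Set σ} {p : MvPolynomial σ k} :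
    p ∈ supported k s ↔ ∀ j ∉ s, p.degreeOf j = 0 := by
  classical
  rw [mem_supported]
  constructor
  · intro h j hj
    by_contra hne
    exact hj (h (by
      rw [Finset.mem_coe, vars_def, Multiset.mem_toFinset, ← Multiset.count_pos, ← degreeOf_def]
      omega))
  · intro h j hj
    by_contra hjs
    rw [Finset.mem_coe, vars_def, Multiset.mem_toFinset, ← Multiset.count_pos, ← degreeOf_def,
      h j hjs] at hj
    omega

theorem Finsupp.eq_single_of_degree_le_one {d : σ →₀ ℕ} (hd : d.degree ≤ 1) {j : σ}
    (hj : d j ≠ 0) : d = Finsupp.single j 1 := by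
  classical
  have hle : Finsupp.single j 1 ≤ d := by
    rw [Finsupp.single_le_iff]
    omega
  have h1 : d = (d - Finsupp.single j 1) + Finsupp.single j 1 := (tsub_add_cancel_of_le hle).symm
  have h2 : (d - Finsupp.single j 1).degree = 0 := by
    have := congrArg Finsupp.degree h1
    simp only [map_add, Finsupp.degree_single] at this
    omega
  rw [Finsupp.degree_eq_zero_iff] at h2
  rw [h1, h2, zero_add]

theorem degreeOf_eq_zero_of_totalDegree_le_one {p : MvPolynomial σ k} (hp : p.totalDegree ≤ 1)
    {j : σ} (hj : p.coeff (Finsupp.single j 1) = 0) : p.degreeOf j = 0 := by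
  rw [← Nat.le_zero, degreeOf_le_iff]
  intro d hd
  by_contra hne
  have := Finsupp.eq_single_of_degree_le_one ((le_totalDegree hd).trans hp) (j := j) (by omega)
  rw [mem_support_iff, this] at hd
  exact hd hj

theorem degreeOf_pos_of_coeff_single_ne_zero {p : MvPolynomial σ k}
    {j : σ} (hj : p.coeff (Finsupp.single j 1) ≠ 0) : 0 < p.degreeOf j := by
  have := monomial_le_degreeOf j (mem_support_iff.2 hj)
  rw [Finsupp.single_eq_same] at this
  omega

theorem eq_sum_of_totalDegree_le_one [Fintype σ] {p : MvPolynomial σ k} (hp : p.totalDegree ≤ 1) :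
    p = ∑ l, C (p.coeff (Finsupp.single l 1)) * X l + C (p.coeff 0) := by
  classical
  ext d
  rw [coeff_add, coeff_sum, coeff_C]
  simp only [coeff_C_mul, coeff_X, mul_ite, mul_one, mul_zero]
  by_cases hd : d = 0
  · subst hd
    simp
  · rw [if_neg (Ne.symm hd), add_zero]
    obtain ⟨j, hj⟩ := Finsupp.ne_iff.1 hd
    by_cases hd1 : d.degree ≤ 1
    · obtain rfl := Finsupp.eq_single_of_degree_le_one hd1 hj
      rw [Finset.sum_eq_single j]
      · simp
      · intro l _ hl
        rw [if_neg]
        exact fun h => hl ((Finsupp.single_left_inj one_ne_zero).1 h)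
      · simp
    · rw [Finset.sum_eq_zero]
      · exact mem_degreeLT_succ.2 hp d (by omega)
      · intro l _
        rw [if_neg]
        rintro rfl
        simp at hd1

end

variable {k : Type*} [Field k] {n m p : ℕ} {Φ : Fin p → Fin m → MvPolynomial (Fin n) k}
  {cls : Fin p → Fin n} {piv : Fin p → Fin m}

/-- A combination of the equations with coefficients in the multiplicative variables has positive
degree with respect to the highest class occurring in it, in a component of that class. -/
theorem IsInvolutiveFirstOrder.exists_degreeOf_pos (hΦ : IsInvolutiveFirstOrder Φ cls piv)
    {P : Fin p → MvPolynomial (Fin n) k} (hP : ∀ τ, P τ ∈ supported k (Set.Iic (cls τ)))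
    {h : Fin n} (hh : ∀ τ, h < cls τ → P τ = 0) {τ : Fin p} (hτ : cls τ = h) (hPτ : P τ ≠ 0) :
    ∃ ρ, cls ρ = h ∧ 0 < ((∑ τ, P τ • Φ τ) (piv ρ)).degreeOf h := by
  classical
  -- Among the equations of class `h`, take the coefficient of greatest degree in `X h`. In the
  -- component `piv ρ` only `Φ ρ` contains `X h`, so this term has strictly larger degree in `X h`
  -- than the others and cannot cancel.
  obtain ⟨ρ, hρ, hmax⟩ := Finset.exists_max_image
    (Finset.univ.filter fun τ => cls τ = h ∧ P τ ≠ 0) (fun τ => (P τ).degreeOf h)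
    ⟨τ, by simp [hτ, hPτ]⟩
  simp only [Finset.mem_filter, Finset.mem_univ, true_and] at hρ hmax
  refine ⟨ρ, hρ.1, ?_⟩
  by_contra hz
  have hz : ((∑ τ, P τ • Φ τ) (piv ρ)).degreeOf h = 0 := by omega
  have heq : P ρ * Φ ρ (piv ρ) = (∑ τ, P τ • Φ τ) (piv ρ) -
      ∑ τ ∈ Finset.univ.erase ρ, P τ * Φ τ (piv ρ) := by
    rw [Finset.sum_apply, ← Finset.add_sum_erase _ _ (Finset.mem_univ ρ)]
    simp
  have hpr : (Φ ρ (piv ρ)).coeff (Finsupp.single h 1) ≠ 0 := by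
    rw [← hρ.1, hΦ.principal ρ]
    exact one_ne_zero
  have hne : Φ ρ (piv ρ) ≠ 0 := by
    intro h0
    simp [h0] at hpr
  have hdeg : (P ρ * Φ ρ (piv ρ)).degreeOf h ≤ (P ρ).degreeOf h := by
    rw [heq]
    refine (degreeOf_sub_le _ _ _).trans (max_le (by omega) ?_)
    refine (degreeOf_sum_le _ _ _).trans (Finset.sup_le fun τ hτ => ?_)
    have hτρ : τ ≠ ρ := Finset.ne_of_mem_erase hτ
    by_cases h0 : P τ = 0
    · simp [h0]
    refine (degreeOf_mul_le _ _ _).trans ?_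
    rcases lt_trichotomy (cls τ) h with hlt | heq | hgt
    · rw [mem_supported_iff_degreeOf.1 (hP τ) h (by simpa using hlt),
        degreeOf_eq_zero_of_totalDegree_le_one (hΦ.order_le τ _) (hΦ.class_le τ _ h hlt)]
      exact Nat.zero_le _
    · rw [degreeOf_eq_zero_of_totalDegree_le_one (hΦ.order_le τ _)
        (by rw [← hρ.1]; exact hΦ.solved ρ τ hτρ), add_zero]
      exact hmax τ ⟨heq, h0⟩
    · exact absurd (hh τ hgt) h0
  rw [degreeOf_mul_eq hρ.2 hne] at hdeg
  have := degreeOf_pos_of_coeff_single_ne_zero hpr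
  omega

/-- Otherwise the highest class with a nonzero coefficient would leave its variable in the sum. -/
theorem IsInvolutiveFirstOrder.eq_zero_of_le_cls (hΦ : IsInvolutiveFirstOrder Φ cls piv)
    {P : Fin p → MvPolynomial (Fin n) k} (hP : ∀ τ, P τ ∈ supported k (Set.Iic (cls τ))) {i : ℕ}
    (hz : ∀ (j : Fin n) (l : Fin m), i ≤ j → ((∑ τ, P τ • Φ τ) l).degreeOf j = 0)
    {τ : Fin p} (hτ : i ≤ cls τ) : P τ = 0 := by
  classical
  by_contra hPτ
  obtain ⟨ρ, hρ, hmax⟩ := Finset.exists_max_image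
    (Finset.univ.filter fun τ => i ≤ cls τ ∧ P τ ≠ 0) cls ⟨τ, by simp [hτ, hPτ]⟩
  simp only [Finset.mem_filter, Finset.mem_univ, true_and] at hρ hmax
  obtain ⟨π, -, hπ⟩ := hΦ.exists_degreeOf_pos hP (h := cls ρ) (fun τ hτ => by
    by_contra h0
    exact (hmax τ ⟨hρ.1.trans (Fin.le_def.1 hτ.le), h0⟩).not_gt hτ) rfl hρ.2
  exact hπ.ne' (hz _ _ hρ.1)

variable (Φ cls) in
/-- The combinations of the equations of class less than `i` (counted from `0`), with coefficients
in the multiplicative variables of the equations. -/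
def multiplicativeSpan (i : ℕ) : Submodule k (Fin m → MvPolynomial (Fin n) k) where
  carrier := {z | ∃ P : Fin p → MvPolynomial (Fin n) k,
    (∀ τ, P τ ∈ supported k (Set.Iic (cls τ))) ∧ (∀ τ, i ≤ cls τ → P τ = 0) ∧
      z = ∑ τ, P τ • Φ τ}
  add_mem' := by
    rintro _ _ ⟨P, hP, hP0, rfl⟩ ⟨Q, hQ, hQ0, rfl⟩
    exact ⟨P + Q, fun τ => add_mem (hP τ) (hQ τ), fun τ h => by simp [hP0 τ h, hQ0 τ h],
      by simp [add_smul, Finset.sum_add_distrib]⟩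
  zero_mem' := ⟨0, fun τ => zero_mem _, fun τ _ => rfl, by simp⟩
  smul_mem' := by
    rintro c _ ⟨P, hP, hP0, rfl⟩
    exact ⟨c • P, fun τ => Subalgebra.smul_mem _ (hP τ) c, fun τ h => by simp [hP0 τ h],
      by simp [Finset.smul_sum]⟩

theorem multiplicativeSpan_mono {i j : ℕ} (h : i ≤ j) :
    multiplicativeSpan Φ cls i ≤ multiplicativeSpan Φ cls j := by
  rintro _ ⟨P, hP, hP0, rfl⟩
  exact ⟨P, hP, fun τ hτ => hP0 τ (h.trans hτ), rfl⟩

theorem smul_mem_multiplicativeSpan {i : ℕ} {τ : Fin p} (hτ : (cls τ : ℕ) < i)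
    {P : MvPolynomial (Fin n) k} (hP : P ∈ supported k (Set.Iic (cls τ))) :
    P • Φ τ ∈ multiplicativeSpan Φ cls i := by
  classical
  refine ⟨Pi.single τ P, fun ρ => ?_, fun ρ hρ => ?_, ?_⟩
  · by_cases h : ρ = τ
    · subst h
      simpa using hP
    · simp [Pi.single_eq_of_ne h, zero_mem]
  · have h : ρ ≠ τ := by
      rintro rfl
      omega
    simp [Pi.single_eq_of_ne h]
  · rw [Finset.sum_eq_single τ]
    · simp
    · intro ρ _ h
      simp [Pi.single_eq_of_ne h]
    · simp

theorem supported_smul_mem_of_X_smul_mem {V : Submodule k (Fin m → MvPolynomial (Fin n) k)}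
    {s : Set (Fin n)} (hV : ∀ j ∈ s, ∀ z ∈ V, (X j : MvPolynomial (Fin n) k) • z ∈ V)
    {P : MvPolynomial (Fin n) k} (hP : P ∈ supported k s)
    {z : Fin m → MvPolynomial (Fin n) k} (hz : z ∈ V) : P • z ∈ V := by
  rw [supported_eq_adjoin_X] at hP
  induction hP using Algebra.adjoin_induction generalizing z with
  | mem _ hx =>
    obtain ⟨j, hj, rfl⟩ := hx
    exact hV j hj z hz
  | algebraMap c =>
    rw [algebraMap_smul]
    exact V.smul_mem c hz
  | add P Q _ _ hP hQ =>
    rw [add_smul]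
    exact add_mem (hP hz) (hQ hz)
  | mul P Q _ _ hP hQ =>
    rw [mul_smul]
    exact hP (hQ hz)

/-- Involution gives a multiplicative expression; since no variable after `X j` occurs in the
prolongation, no class above `j` does. -/
theorem IsInvolutiveFirstOrder.X_smul_mem_multiplicativeSpan
    (hΦ : IsInvolutiveFirstOrder Φ cls piv) (τ : Fin p) (j : Fin n) (hj : cls τ < j) :
    (X j : MvPolynomial (Fin n) k) • Φ τ ∈ multiplicativeSpan Φ cls (j + 1) := by
  have hle : Submodule.span k (Set.range Φ ∪ {Ψ | ∃ σ i, i ≤ cls σ ∧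
      Ψ = (X i : MvPolynomial (Fin n) k) • Φ σ}) ≤ multiplicativeSpan Φ cls n := by
    rw [Submodule.span_le]
    rintro _ (⟨σ, rfl⟩ | ⟨σ, i, hi, rfl⟩)
    · simpa using smul_mem_multiplicativeSpan (Φ := Φ) (cls σ).2
        (one_mem (supported k (Set.Iic (cls σ))))
    · exact smul_mem_multiplicativeSpan (cls σ).2 (X_mem_supported.2 hi)
  obtain ⟨P, hP, -, hz⟩ := hle (hΦ.prolongation τ j)
  refine ⟨P, hP, fun ρ hρ => hΦ.eq_zero_of_le_cls hP (fun i l hi => ?_) hρ, hz⟩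
  rw [← hz, Pi.smul_apply, smul_eq_mul, ← Nat.le_zero]
  have hji : j < i := Fin.lt_def.2 hi
  refine (degreeOf_mul_le _ _ _).trans ?_
  rw [degreeOf_X_of_ne (ne_of_gt hji), degreeOf_eq_zero_of_totalDegree_le_one (hΦ.order_le τ l)
    (hΦ.class_le τ l i (hj.trans hji))]

theorem IsInvolutiveFirstOrder.smul_mem_multiplicativeSpan_of_lt
    (hΦ : IsInvolutiveFirstOrder Φ cls piv) (i : ℕ) (j : Fin n) (hj : (j : ℕ) < i)
    {z : Fin m → MvPolynomial (Fin n) k} (hz : z ∈ multiplicativeSpan Φ cls i) :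
    (X j : MvPolynomial (Fin n) k) • z ∈ multiplicativeSpan Φ cls i := by
  induction i generalizing j z with
  | zero => omega
  | succ i ih =>
    obtain ⟨P, hP, hP0, rfl⟩ := hz
    rw [Finset.smul_sum]
    refine sum_mem fun τ _ => ?_
    by_cases hτi : i + 1 ≤ cls τ
    · simp [hP0 τ hτi, zero_mem]
    rw [smul_smul]
    by_cases hjτ : j ≤ cls τ
    · exact smul_mem_multiplicativeSpan (by omega) (mul_mem (X_mem_supported.2 hjτ) (hP τ))
    push Not at hjτ
    by_cases hji : (j : ℕ) < i
    · rw [mul_smul]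
      exact multiplicativeSpan_mono (Nat.le_succ i)
        (ih j hji (smul_mem_multiplicativeSpan ((Fin.lt_def.1 hjτ).trans hji) (hP τ)))
    -- The nonmultiplicative case with `X j` the last admitted variable. Expand `X j • Φ τ` and
    -- apply `P τ`, whose variables precede `X j`: they are multiplicative for class `j`, and the
    -- induction hypothesis covers the lower classes.
    obtain rfl : i = j := by omega
    rw [mul_comm, mul_smul]
    obtain ⟨Q, hQ, hQ0, hz⟩ := hΦ.X_smul_mem_multiplicativeSpan τ j hjτ
    rw [hz, Finset.smul_sum]
    refine sum_mem fun ρ _ => ?_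
    rcases lt_trichotomy (cls ρ) j with hlt | heq | hgt
    · refine multiplicativeSpan_mono (Nat.le_succ (j : ℕ))
        (supported_smul_mem_of_X_smul_mem (s := Set.Iic (cls τ)) (fun l hl z hz => ih l ?_ hz)
          (hP τ) (smul_mem_multiplicativeSpan hlt (hQ ρ)))
      exact Fin.lt_def.1 (lt_of_le_of_lt hl hjτ)
    · rw [smul_smul]
      refine smul_mem_multiplicativeSpan (by rw [heq]; omega) (mul_mem ?_ (hQ ρ))
      exact supported_mono (Set.Iic_subset_Iic.2 (heq ▸ hjτ.le)) (hP τ)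
    · simp [hQ0 ρ (Fin.lt_def.1 hgt), zero_mem]

/-- The module of the equations is spanned by the prolongations with respect to the multiplicative
variables. -/
theorem IsInvolutiveFirstOrder.span_le_multiplicativeSpan (hΦ : IsInvolutiveFirstOrder Φ cls piv)
    {z : Fin m → MvPolynomial (Fin n) k}
    (hz : z ∈ Submodule.span (MvPolynomial (Fin n) k) (Set.range Φ)) :
    z ∈ multiplicativeSpan Φ cls n := by
  induction hz using Submodule.span_induction with
  | mem _ h =>
    obtain ⟨σ, rfl⟩ := h
    simpa using smul_mem_multiplicativeSpan (Φ := Φ) (cls σ).2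
      (one_mem (supported k (Set.Iic (cls σ))))
  | zero => exact zero_mem _
  | add _ _ _ _ hx hy => exact add_mem hx hy
  | smul a z _ hz =>
    exact supported_smul_mem_of_X_smul_mem (s := Set.univ)
      (fun j _ z hz => hΦ.smul_mem_multiplicativeSpan_of_lt n j j.2 hz) (by simp) hz

variable {M : Type*} [AddCommGroup M] [Module (MvPolynomial (Fin n) k) M] {y : Fin m → M}

/-- If not all the jets of class `h` are principal, then some generator is free over the
polynomials in the variables up to `h`. -/
theorem IsInvolutiveFirstOrder.isFreeElement (hΦ : IsInvolutiveFirstOrder Φ cls piv)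
    (hker : LinearMap.ker (Fintype.linearCombination (MvPolynomial (Fin n) k) y) =
      Submodule.span (MvPolynomial (Fin n) k) (Set.range Φ)) {s : ℕ} (hs : s + 1 ≤ n) {l : Fin m}
    (hl : ∀ σ, (cls σ : ℕ) = s → piv σ ≠ l) : IsFreeElement k n M hs (y l) := by
  classical
  intro P hP
  by_contra hP0
  let h : Fin n := ⟨s, hs⟩
  have hQ0 : rename (Fin.castLE hs) P ≠ 0 := by
    rwa [Ne, map_eq_zero_iff _ (rename_injective _ (Fin.castLE_injective hs))]
  set Q := rename (Fin.castLE hs) P with hQ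
  have hdeg : ∀ j : Fin n, h < j → (X h * Q).degreeOf j = 0 := by
    intro j hj
    rw [degreeOf_mul_eq (X_ne_zero h) hQ0, degreeOf_X_of_ne (ne_of_gt hj), zero_add]
    refine (mem_supported_iff_degreeOf (s := Set.range (Fin.castLE hs))).1 ?_ j ?_
    · rw [mem_supported]
      intro x hx
      obtain ⟨i, -, rfl⟩ := Finset.mem_image.1 (vars_rename _ _ hx)
      exact ⟨i, rfl⟩
    · rintro ⟨i, rfl⟩
      have := Fin.lt_def.1 hj
      simp [h] at this
      omega
  -- The extra factor `X h` guarantees that the relation really involves `X h`, whatever `P` is.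
  have hmem : Pi.single l (X h * Q) ∈ Submodule.span (MvPolynomial (Fin n) k) (Set.range Φ) := by
    rw [← hker, LinearMap.mem_ker, Fintype.linearCombination_apply_single, mul_smul, hP, smul_zero]
  obtain ⟨R, hR, -, hz⟩ := hΦ.span_le_multiplicativeSpan hmem
  have hR1 : ∀ τ, s + 1 ≤ cls τ → R τ = 0 := by
    intro τ hτ
    refine hΦ.eq_zero_of_le_cls hR (fun j l' hj => ?_) hτ
    rw [← hz]
    by_cases hll : l' = l
    · subst hll
      rw [Pi.single_eq_same]
      exact hdeg j (Fin.lt_def.2 hj)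
    · simp [Pi.single_eq_of_ne hll]
  have hR2 : ∀ τ, cls τ = h → R τ = 0 := by
    intro τ hτ
    -- A nonzero coefficient of class `h` would leave `X h` in a component `piv ρ ≠ l`, where the
    -- relation is zero.
    by_contra hne
    obtain ⟨ρ, hρ, hpos⟩ := hΦ.exists_degreeOf_pos hR (h := h)
      (fun τ hτ => hR1 τ (Fin.lt_def.1 hτ)) hτ hne
    rw [← hz, Pi.single_eq_of_ne (hl ρ (by rw [hρ]))] at hpos
    simp at hpos
  have hpos : 0 < (X h * Q).degreeOf h := by
    rw [degreeOf_mul_eq (X_ne_zero h) hQ0, degreeOf_X_self]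
    omega
  refine hpos.ne' ?_
  have hzl : X h * Q = ∑ τ, R τ * Φ τ l := by
    have := congrFun hz l
    simpa using this
  rw [hzl, ← Nat.le_zero]
  refine (degreeOf_sum_le _ _ _).trans (Finset.sup_le fun τ _ => ?_)
  rcases lt_trichotomy (cls τ) h with hlt | heq | hgt
  · refine (degreeOf_mul_le _ _ _).trans ?_
    rw [mem_supported_iff_degreeOf.1 (hR τ) h (by simpa using hlt),
      degreeOf_eq_zero_of_totalDegree_le_one (hΦ.order_le τ _) (hΦ.class_le τ _ h hlt)]
  · simp [hR2 τ heq]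
  · simp [hR1 τ (Fin.lt_def.1 hgt)]

/-- If all the jets of class at least `s` (counted from `0`) are principal, then the annihilator is
triangular. -/
theorem IsInvolutiveFirstOrder.isTriangular (hΦ : IsInvolutiveFirstOrder Φ cls piv)
    (hy : Submodule.span (MvPolynomial (Fin n) k) (Set.range y) = ⊤)
    (hker : LinearMap.ker (Fintype.linearCombination (MvPolynomial (Fin n) k) y) =
      Submodule.span (MvPolynomial (Fin n) k) (Set.range Φ)) {s : ℕ}
    (hfull : ∀ h : Fin n, s ≤ h → ∀ l, ∃ σ, cls σ = h ∧ piv σ = l) :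
    IsTriangular s (Module.annihilator (MvPolynomial (Fin n) k) M) := by
  classical
  intro h hsh
  choose σ hσ hpiv using hfull h hsh
  -- Row `i` is the equation with principal jet `y^i` of class `h`. The diagonal coefficients of `X
  -- h` form the scalar part and are removed from `b`; the off-diagonal ones vanish because the
  -- system is solved.
  refine ⟨m, fun i j l => if i = j ∧ l = h then 0 else (Φ (σ i) j).coeff (Finsupp.single l 1),
    fun i j => (Φ (σ i) j).coeff 0, ?_, ?_⟩
  · intro i j l hl
    dsimp only
    split_ifs with hij
    · rfl
    · rcases hl.lt_or_eq with hlt | rfl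
      · exact hΦ.class_le _ _ _ (by rwa [hσ])
      · have hne : i ≠ j := fun hij' => hij ⟨hij', rfl⟩
        have := hΦ.solved (σ j) (σ i) (by
          intro he
          exact hne (by rw [← hpiv i, he, hpiv j]))
        rwa [hpiv, hσ] at this
  · have hmat : linearMatrix h
        (fun i j l => if i = j ∧ l = h then 0 else (Φ (σ i) j).coeff (Finsupp.single l 1))
        (fun i j => (Φ (σ i) j).coeff 0) = Matrix.of fun i j => Φ (σ i) j := by
      refine Matrix.ext fun i j => ?_
      refine Eq.trans ?_ (eq_sum_of_totalDegree_le_one (hΦ.order_le (σ i) j)).symm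
      rw [linearMatrix, Matrix.add_apply, Matrix.of_apply, ← add_assoc]
      congr 1
      · by_cases hij : i = j
        · subst hij
          rw [← Finset.add_sum_erase _ _ (Finset.mem_univ h),
            ← Finset.add_sum_erase _ _ (Finset.mem_univ h)]
          have hpr := hΦ.principal (σ i)
          rw [hpiv, hσ] at hpr
          rw [← add_assoc]
          congr 1
          · simp [hpr]
          · refine Finset.sum_congr rfl fun l hl => ?_
            simp [Finset.ne_of_mem_erase hl]
        · simp [hij]
    rw [hmat]
    have hrow : ∀ i, ∑ j, (Matrix.of fun i j => Φ (σ i) j) i j • y j = 0 := by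
      intro i
      have : Φ (σ i) ∈ LinearMap.ker (Fintype.linearCombination (MvPolynomial (Fin n) k) y) := by
        rw [hker]
        exact Submodule.subset_span ⟨σ i, rfl⟩
      rwa [LinearMap.mem_ker, Fintype.linearCombination_apply] at this
    have hle : (⊤ : Submodule (MvPolynomial (Fin n) k) M) ≤ LinearMap.ker
        (LinearMap.lsmul (MvPolynomial (Fin n) k) M (Matrix.of fun i j => Φ (σ i) j).det) := by
      rw [← hy, Submodule.span_le]
      rintro _ ⟨j, rfl⟩
      exact Matrix.det_smul_eq_zero _ y hrow j
    exact Module.mem_annihilator.2 fun x => hle (Submodule.mem_top (x := x))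

end Involution

/-! ### Relative localization and the choice of `s` -/

section Purity

open MvPolynomial

variable {k : Type*} [Field k] {n : ℕ}

/-- Tensoring with the fraction field is localization at the nonzero polynomials, so the kernel
consists of the torsion elements. -/
theorem injective_relativeLocalizationMap_iff {M : Type*} [AddCommGroup M]
    [Module (MvPolynomial (Fin n) k) M] {s : ℕ} (hs : s ≤ n) :
    Function.Injective (relativeLocalizationMap k n M hs) ↔
      ∀ x : M, x ≠ 0 → IsFreeElement k n M hs x := by
  let := restrictVariables k n M hs
  let f : M →ₗ[MvPolynomial (Fin s) k] FractionRing (MvPolynomial (Fin s) k)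
      ⊗[MvPolynomial (Fin s) k] M := TensorProduct.mk _ _ M 1
  have hf : ∀ x, f x = 0 ↔ ∃ p : nonZeroDivisors (MvPolynomial (Fin s) k), p • x = 0 :=
    fun x => IsLocalizedModule.eq_zero_iff (nonZeroDivisors (MvPolynomial (Fin s) k)) f
  have hsmul : ∀ (p : MvPolynomial (Fin s) k) (x : M), p • x = rename (Fin.castLE hs) p • x :=
    fun _ _ => rfl
  change Function.Injective f ↔ _
  rw [injective_iff_map_eq_zero]
  refine forall_congr' fun x => ?_
  rw [hf]
  constructor
  · intro h hx p hp
    by_contra hp0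
    exact hx (h ⟨⟨p, mem_nonZeroDivisors_of_ne_zero hp0⟩, hp⟩)
  · rintro h ⟨⟨p, hp⟩, hpx⟩
    by_contra hx
    exact nonZeroDivisors.ne_zero hp (h hx p hpx)

/-- For an involutive system there is some `s` such that the module is finite over the polynomials
in the first `s` variables and has a generator which is free over them. -/
theorem IsInvolutiveFirstOrder.exists_isTriangular_isFreeElement {m p : ℕ}
    {Φ : Fin p → Fin m → MvPolynomial (Fin n) k} {cls : Fin p → Fin n} {piv : Fin p → Fin m}
    (hΦ : IsInvolutiveFirstOrder Φ cls piv)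
    {M : Type*} [AddCommGroup M] [Module (MvPolynomial (Fin n) k) M] [Nontrivial M] {y : Fin m → M}
    (hy : Submodule.span (MvPolynomial (Fin n) k) (Set.range y) = ⊤)
    (hker : LinearMap.ker (Fintype.linearCombination (MvPolynomial (Fin n) k) y) =
      Submodule.span (MvPolynomial (Fin n) k) (Set.range Φ)) :
    ∃ (s : ℕ) (hs : s ≤ n), IsTriangular s (Module.annihilator (MvPolynomial (Fin n) k) M) ∧
      ∃ l, IsFreeElement k n M hs (y l) := by
  classical
  have hex : ∃ s : ℕ, ∀ h : Fin n, s ≤ h → ∀ l, ∃ σ, cls σ = h ∧ piv σ = l :=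
    ⟨n, fun h hh => absurd h.2 hh.not_gt⟩
  have hle : Nat.find hex ≤ n := Nat.find_le fun h hh => absurd h.2 hh.not_gt
  refine ⟨Nat.find hex, hle, hΦ.isTriangular hy hker (Nat.find_spec hex), ?_⟩
  have hmin : ∀ t < Nat.find hex, ¬ _ := fun t ht => Nat.find_min hex ht
  have hspec := Nat.find_spec hex
  generalize Nat.find hex = s at hle hmin hspec
  cases s with
  -- Over `k` itself every nonzero generator is free.
  | zero =>
    obtain ⟨l, hl⟩ : ∃ l, y l ≠ 0 := by
      by_contra! h
      have hbot : (⊤ : Submodule (MvPolynomial (Fin n) k) M) ≤ ⊥ := by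
        rw [← hy, Submodule.span_le]
        rintro _ ⟨l, rfl⟩
        exact h l
      exact bot_ne_top (le_antisymm bot_le hbot)
    refine ⟨l, fun P hP => ?_⟩
    rw [MvPolynomial.eq_C_of_isEmpty P] at hP ⊢
    rw [MvPolynomial.rename_C] at hP
    by_contra hne
    have hc : P.coeff 0 ≠ 0 := fun h0 => hne (by rw [h0, map_zero])
    have := congrArg (fun x => (MvPolynomial.C (P.coeff 0)⁻¹ : MvPolynomial (Fin n) k) • x) hP
    simp only [smul_smul, ← map_mul, inv_mul_cancel₀ hc, map_one, one_smul, smul_zero] at this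
    exact hl this
  | succ s =>
    have h := hmin s (Nat.lt_succ_self s)
    push Not at h
    obtain ⟨h, hsh, l, hl⟩ := h
    -- Minimality gives a nonprincipal jet of index at least `s`; all jets of larger index are
    -- principal.
    have hh : (h : ℕ) = s := by
      by_contra hne
      obtain ⟨σ, hσ, hσl⟩ := hspec h (by omega) l
      exact hl σ hσ hσl
    exact ⟨l, hΦ.isFreeElement hker hle fun σ hσ => hl σ (Fin.ext (hσ.trans hh.symm))⟩

end Purity

theorem corollary5p10 {k : Type*} [Field k] {n m p : ℕ}
    (Φ : Fin p → Fin m → MvPolynomial (Fin n) k) (cls : Fin p → Fin n) (piv : Fin p → Fin m)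
    (hΦ : IsInvolutiveFirstOrder Φ cls piv)
    {M : Type*} [AddCommGroup M] [Module (MvPolynomial (Fin n) k) M] [Nontrivial M]
    (y : Fin m → M)
    (hy : Submodule.span (MvPolynomial (Fin n) k) (Set.range y) = ⊤)
    (hker : LinearMap.ker (Fintype.linearCombination (MvPolynomial (Fin n) k) y) =
      Submodule.span (MvPolynomial (Fin n) k) (Set.range Φ))
    (r : ℕ) (hr : r ≤ n) :
    IsPure k n M r ↔
      codim k n M = (r : ℕ∞) ∧
        Function.Injective (relativeLocalizationMap k n M (Nat.sub_le n r)) := by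
  have hfin : Module.Finite (MvPolynomial (Fin n) k) M :=
    ⟨hy ▸ Submodule.fg_span (Set.finite_range y)⟩
  obtain ⟨s, hs, htri, l, hl⟩ := hΦ.exists_isTriangular_isFreeElement hy hker
  have hcd : codim k n M = ((n - s : ℕ) : ℕ∞) :=
    le_antisymm (htri.codim_le hs hl) (htri.le_codim hs)
  rw [injective_relativeLocalizationMap_iff]
  constructor
  · rintro ⟨h0, h1⟩
    have hsr : n - s = r := by
      refine le_antisymm ?_ ?_
      -- A nonzero `x` is not in `t_r(M)`, so `n - s ≤ cd(Dx) ≤ r`.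
      · obtain ⟨x, hx⟩ := exists_ne (0 : M)
        have hxr : x ∉ purityFiltration k n M r := by
          rw [h0]
          exact hx
        have h2 := (htri.le_codim_span hs x).trans (not_lt.1 hxr)
        exact_mod_cast h2
      · cases r with
        | zero => exact Nat.zero_le _
        | succ r =>
          -- The free generator has `cd(D y l) ≤ n - s`, while purity makes this codimension greater
          -- than `r`, the predecessor of the index.
          have h2 : y l ∈ purityFiltration k n M r := by
            rw [h1 r rfl]
            exact Set.mem_univ _
          have h3 := not_lt.1 (mt (htri.lt_codim_span_iff hs (y l)).1 (not_not.2 hl))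
          have h4 := lt_of_lt_of_le h2 h3
          exact_mod_cast h4
    obtain rfl : s = n - r := by omega
    refine ⟨by rw [hcd, hsr], fun x hx => ?_⟩
    by_contra hfree
    have hxr : x ∈ purityFiltration k n M r := by
      have h2 := (htri.lt_codim_span_iff hs x).2 hfree
      rwa [hsr] at h2
    rw [h0] at hxr
    exact hx hxr
  · rintro ⟨h0, h1⟩
    have hsr : n - s = r := by
      rw [hcd] at h0
      exact_mod_cast h0
    obtain rfl : s = n - r := by omega
    have hlt : ∀ x : M, x ∈ purityFiltration k n M r ↔ ¬ IsFreeElement k n M hs x := fun x => by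
      rw [← htri.lt_codim_span_iff hs x, hsr]
      rfl
    refine ⟨Set.ext fun x => ?_, fun t ht => Set.eq_univ_of_forall fun x => ?_⟩
    · rw [hlt, Set.mem_singleton_iff]
      refine ⟨fun hx => by_contra fun hne => hx (h1 x hne), ?_⟩
      rintro rfl hfree
      exact one_ne_zero (hfree 1 (smul_zero _))
    · refine lt_of_lt_of_le ?_ (htri.le_codim_span hs x)
      rw [hsr]
      exact_mod_cast (by omega : t < r)
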